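/- Let $d\in\mathbb N$. For $\delta>0$ and a bounded set $A\subset\mathbb R^d$ let $N_\delta(A)$ be the least number of open Euclidean balls of radius $\delta$ required to cover $A$, and let $B(x,\delta)$ be the open ball with centre $x$ and radius $\delta$. For $F\subset\mathbb R^d$ and $\theta\in(0,1)$, the Assouad spectrum of $F$ at $\theta$ is $$\dim_{\mathrm A}^{\theta}F=\inf\Bigl\{\alpha\in\mathbb R:(\exists C>0)(\forall\,0<\delta\le 1)(\forall x\in F)\ \ N_{\delta^{1/\theta}}\bigl(F\cap B(x,\delta)\bigr)\le C\Bigl(\frac{\delta}{\delta^{1/\theta}}\Bigr)^{\alpha}\Bigr\}.$$ Let $\varphi\colon(0,1)\to[0,d]$ be an increasing (that is, non-decreasing) function. Then there exists a set $F\subset\mathbb R^d$ such that $\dim_{\mathrm A}^{\theta}F=\varphi(\theta)$ for all $\theta\in(0,1)$ if and only if the function $\theta\mapsto(1-\theta)\varphi(\theta)$ is decreasing (that is, non-increasing) on $(0,1)$. -/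

import Mathlib

noncomputable section

namespace AssouadForms

/-- `N_δ(A)`: the least number of open balls of radius `δ` (with arbitrary centres in the ambient
space) that are required to cover `A`. It is used only for bounded `A` in a Euclidean space and
`δ > 0`, where a finite cover exists (see `exists_cover_card_eq`). -/
def coverNum {E : Type*} [PseudoMetricSpace E] (δ : ℝ) (A : Set E) : ℕ :=
  sInf {n : ℕ | ∃ t : Finset E, t.card = n ∧ A ⊆ ⋃ y ∈ t, Metric.ball y δ}

/-- For bounded sets the minimum in the definition of `coverNum` is over a non-empty set,
so it is attained by an actual cover. -/
theorem exists_cover_card_eq {E : Type*} [PseudoMetricSpace E] [ProperSpace E]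
    {δ : ℝ} (hδ : 0 < δ) {A : Set E} (hA : Bornology.IsBounded A) :
    ∃ t : Finset E, t.card = coverNum δ A ∧ A ⊆ ⋃ y ∈ t, Metric.ball y δ := by
  have hne : {n : ℕ | ∃ t : Finset E, t.card = n ∧ A ⊆ ⋃ y ∈ t, Metric.ball y δ}.Nonempty := by
    have htb : TotallyBounded A :=
      hA.isCompact_closure.totallyBounded.subset subset_closure
    obtain ⟨s, hs, hcov⟩ := Metric.totallyBounded_iff.1 htb δ hδ
    exact ⟨hs.toFinset.card, hs.toFinset, rfl, by simpa using hcov⟩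
  exact Nat.sInf_mem hne

/-- The exponents `α` admissible in the definition of the Assouad spectrum of `F` at `θ`. -/
def admissibleExponents {E : Type*} [PseudoMetricSpace E] (θ : ℝ) (F : Set E) : Set ℝ :=
  {α : ℝ | ∃ C : ℝ, 0 < C ∧ ∀ δ : ℝ, 0 < δ → δ ≤ 1 → ∀ x ∈ F,
    (coverNum (δ ^ (1 / θ)) (F ∩ Metric.ball x δ) : ℝ) ≤ C * (δ / δ ^ (1 / θ)) ^ α}

/-- The Assouad spectrum of `F` at `θ`. The infimum is taken in the extended reals, so that no
convention for infima of unbounded or empty sets of reals intervenes. -/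
def assouadSpectrum {E : Type*} [PseudoMetricSpace E] (θ : ℝ) (F : Set E) : EReal :=
  sInf ((fun α : ℝ => (α : EReal)) '' admissibleExponents θ F)

end AssouadForms

end

open Set

namespace AssouadForms

/-! ### Covering numbers -/

/-! Necessity: for `lam ≤ θ`, a ball of radius `δ` lies in the concentric ball of radius `δ ^ (lam /
θ)`, and the exponent `1 / lam` takes this radius to the same fine scale `δ ^ (1 / θ)`; comparing
the two bounds costs the factor `(1 - lam) / (1 - θ)`. Sufficiency: put `ψ = φ / d` and `g t = (1 -
t) ψ t`. Then `g` is non-increasing and falls with slope at most `1`, so the floors of `N g (j / N)`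
drop by `0` or `1` at each `j`. Binary digits are left free exactly at the drops. In the `d`-fold
product, passing from scale `2 ^ (-L)` to `2 ^ (-L / θ)` then meets about `d N (g (L / N) - g (L /
(θ N)))` free digits. This is at most `d (L / θ - L) ψ θ` (`profile_sub_le`), with equality at `L =
N θ`, because `g` vanishes at `1`. Placing the products for all `N` far apart realises `d ψ = φ`. -/

theorem coverNum_le_card {E : Type*} [PseudoMetricSpace E] {δ : ℝ} {A : Set E} (t : Finset E)
    (h : A ⊆ ⋃ y ∈ t, Metric.ball y δ) : coverNum δ A ≤ t.card :=
  Nat.sInf_le ⟨t, rfl, h⟩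

theorem coverNum_mono {E : Type*} [PseudoMetricSpace E] [ProperSpace E] {δ : ℝ} (hδ : 0 < δ)
    {A B : Set E} (hB : Bornology.IsBounded B) (h : A ⊆ B) : coverNum δ A ≤ coverNum δ B := by
  obtain ⟨t, ht, hcov⟩ := exists_cover_card_eq hδ hB
  exact ht ▸ coverNum_le_card t (h.trans hcov)

/-- A family of points at mutual distance at least `2 δ` needs as many balls as points. -/
theorem card_le_coverNum {E ι : Type*} [PseudoMetricSpace E] [ProperSpace E] {δ : ℝ} (hδ : 0 < δ)
    {A : Set E} (hA : Bornology.IsBounded A) (s : Finset ι) (f : ι → E)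
    (hf : ∀ a ∈ s, f a ∈ A) (hsep : ∀ a ∈ s, ∀ b ∈ s, a ≠ b → 2 * δ ≤ dist (f a) (f b)) :
    s.card ≤ coverNum δ A := by
  obtain ⟨t, ht, hcov⟩ := exists_cover_card_eq hδ hA
  rw [← ht]
  rcases s.eq_empty_or_nonempty with rfl | ⟨a₀, -⟩
  · simp
  have : Nonempty E := ⟨f a₀⟩
  have h1 : ∀ a ∈ s, ∃ y ∈ t, dist (f a) y < δ := by
    intro a ha
    simpa using hcov (hf a ha)
  choose! c hct hc using h1
  refine Finset.card_le_card_of_injOn c hct ?_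
  intro a ha b hb hab
  by_contra hne
  have h2 := hsep a ha b hb hne
  have h3 := dist_triangle_right (f a) (f b) (c a)
  have h4 := hc a ha
  have h5 := hc b hb
  rw [← hab] at h5
  linarith

/-! ### Necessity -/

theorem mem_admissibleExponents_of_le {E : Type*} [PseudoMetricSpace E] [ProperSpace E] {F : Set E}
    {lam θ α : ℝ} (hlam : 0 < lam) (hle : lam ≤ θ) (hθ : θ < 1)
    (hα : α ∈ admissibleExponents lam F) :
    α * (1 - lam) / (1 - θ) ∈ admissibleExponents θ F := by
  obtain ⟨C, hC, H⟩ := hα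
  have hθ0 : 0 < θ := hlam.trans_le hle
  refine ⟨C, hC, fun δ hδ hδ1 x hx => ?_⟩
  have hη1 : δ ^ (lam / θ) ≤ 1 := Real.rpow_le_one hδ.le hδ1 (by positivity)
  have hη : 0 < δ ^ (lam / θ) := Real.rpow_pos_of_pos hδ _
  have hle' : δ ≤ δ ^ (lam / θ) := by
    conv_lhs => rw [← Real.rpow_one δ]
    exact Real.rpow_le_rpow_of_exponent_ge hδ hδ1 ((div_le_one hθ0).2 hle)
  have hpow : (δ ^ (lam / θ)) ^ (1 / lam) = δ ^ (1 / θ) := by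
    rw [← Real.rpow_mul hδ.le]
    congr 1
    field_simp
  have h := H _ hη hη1 x hx
  rw [hpow] at h
  have hmono : coverNum (δ ^ (1 / θ)) (F ∩ Metric.ball x δ) ≤
      coverNum (δ ^ (1 / θ)) (F ∩ Metric.ball x (δ ^ (lam / θ))) :=
    coverNum_mono (Real.rpow_pos_of_pos hδ _) (Metric.isBounded_ball.subset inter_subset_right)
      (inter_subset_inter_right _ (Metric.ball_subset_ball hle'))
  refine (Nat.cast_le.2 hmono).trans (h.trans_eq ?_)
  have h1 : δ / δ ^ (1 / θ) = δ ^ (1 - 1 / θ) := by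
    rw [Real.rpow_sub hδ, Real.rpow_one]
  rw [h1, ← Real.rpow_sub hδ, ← Real.rpow_mul hδ.le, ← Real.rpow_mul hδ.le]
  congr 2
  have : 1 - θ ≠ 0 := by linarith
  field_simp
  ring

theorem antitoneOn_of_assouadSpectrum_eq {E : Type*} [PseudoMetricSpace E] [ProperSpace E]
    {F : Set E} {φ : ℝ → ℝ} (h : ∀ θ ∈ Ioo (0 : ℝ) 1, assouadSpectrum θ F = (φ θ : EReal)) :
    AntitoneOn (fun θ : ℝ => (1 - θ) * φ θ) (Ioo (0 : ℝ) 1) := by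
  intro lam hlam θ hθ hle
  have h1 : 0 < 1 - θ := by linarith [hθ.2]
  have h2 : 0 < 1 - lam := by linarith [hlam.2]
  have key : ∀ α ∈ admissibleExponents lam F, (1 - θ) * φ θ / (1 - lam) ≤ α := by
    intro α hα
    have h3 : assouadSpectrum θ F ≤ ((α * (1 - lam) / (1 - θ) : ℝ) : EReal) :=
      sInf_le ⟨_, mem_admissibleExponents_of_le hlam.1 hle hθ.2 hα, rfl⟩
    rw [h θ hθ, EReal.coe_le_coe_iff, le_div_iff₀ h1] at h3
    rw [div_le_iff₀ h2]
    linarith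
  have h4 : (((1 - θ) * φ θ / (1 - lam) : ℝ) : EReal) ≤ assouadSpectrum lam F := by
    refine le_sInf ?_
    rintro _ ⟨α, hα, rfl⟩
    exact EReal.coe_le_coe_iff.2 (key α hα)
  rw [h lam hlam, EReal.coe_le_coe_iff, div_le_iff₀ h2] at h4
  simp only
  linarith

/-! ### Sets of binary expansions with prescribed free digits -/

/-- The number whose binary digits equal to `1` sit at the positions in `A`. -/
noncomputable def digitSum (A : Finset ℕ) : ℝ := ∑ j ∈ A, (1 / 2 : ℝ) ^ (j + 1)

/-- The numbers with finite binary expansions whose digits vanish outside of `P`. -/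
def digitSet (P : ℕ → Prop) : Set ℝ := {x | ∃ A : Finset ℕ, (∀ j ∈ A, P j) ∧ digitSum A = x}

theorem digitSum_nonneg (A : Finset ℕ) : 0 ≤ digitSum A :=
  Finset.sum_nonneg fun _ _ => by positivity

theorem digitSum_Ico {k m : ℕ} (h : k ≤ m) :
    digitSum (Finset.Ico k m) = (1 / 2 : ℝ) ^ k - (1 / 2) ^ m := by
  induction m, h using Nat.le_induction with
  | base => simp [digitSum]
  | succ m hm ih =>
    rw [digitSum, Finset.sum_Ico_succ_top hm, ← digitSum, ih]
    ring

theorem digitSum_lt {A : Finset ℕ} {k : ℕ} (h : ∀ j ∈ A, k ≤ j) : digitSum A < (1 / 2 : ℝ) ^ k := by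
  have hsub : A ⊆ Finset.Ico k (max k (A.sup id + 1)) := by
    intro j hj
    have := Finset.le_sup (f := id) hj
    simp only [id] at this
    simp only [Finset.mem_Ico]
    exact ⟨h j hj, by omega⟩
  have h1 : digitSum A ≤ digitSum (Finset.Ico k (max k (A.sup id + 1))) :=
    Finset.sum_le_sum_of_subset_of_nonneg hsub fun _ _ _ => by positivity
  rw [digitSum_Ico (le_max_left _ _)] at h1
  have : (0 : ℝ) < (1 / 2) ^ (max k (A.sup id + 1)) := by positivity
  linarith

theorem digitSum_lt_one (A : Finset ℕ) : digitSum A < 1 := by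
  simpa using digitSum_lt (A := A) (k := 0) (by simp)

theorem digitSum_filter_add (A : Finset ℕ) (k : ℕ) :
    digitSum (A.filter (· < k)) + digitSum (A.filter (k ≤ ·)) = digitSum A := by
  have := Finset.sum_filter_add_sum_filter_not A (· < k) (fun j => (1 / 2 : ℝ) ^ (j + 1))
  simpa [digitSum] using this

theorem digitSum_eq_natCast_mul {A : Finset ℕ} {n : ℕ} (h : ∀ j ∈ A, j < n) :
    digitSum A = ((∑ i ∈ A.image (n - 1 - ·), 2 ^ i : ℕ) : ℝ) * (1 / 2) ^ n := by
  rw [Finset.sum_image, digitSum]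
  · push_cast
    rw [Finset.sum_mul]
    refine Finset.sum_congr rfl fun j hj => ?_
    obtain ⟨l, rfl⟩ := Nat.exists_eq_add_of_lt (h j hj)
    have : j + l + 1 - 1 - j = l := by omega
    rw [this, show j + l + 1 = l + (j + 1) by ring, pow_add (1 / 2 : ℝ) l, ← mul_assoc, ← mul_pow]
    norm_num
  · intro a ha b hb hab
    have := h a ha
    have := h b hb
    simp only at hab
    omega

/-- Both sums are integer multiples of `(1 / 2) ^ n`, and by uniqueness of binary expansions the
integers differ. -/
theorem le_abs_digitSum_sub {A B : Finset ℕ} {n : ℕ} (hA : ∀ j ∈ A, j < n) (hB : ∀ j ∈ B, j < n)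
    (hne : A ≠ B) : (1 / 2 : ℝ) ^ n ≤ |digitSum A - digitSum B| := by
  have hinj : ∀ {A B : Finset ℕ}, (∀ j ∈ A, j < n) → (∀ j ∈ B, j < n) →
      A.image (n - 1 - ·) = B.image (n - 1 - ·) → A ⊆ B := by
    intro A B hA hB h j hj
    have h1 : n - 1 - j ∈ B.image (n - 1 - ·) := h ▸ Finset.mem_image_of_mem _ hj
    obtain ⟨i, hi, hij⟩ := Finset.mem_image.1 h1
    have := hA j hj
    have := hB i hi
    have : i = j := by omega
    exact this ▸ hi
  rw [digitSum_eq_natCast_mul hA, digitSum_eq_natCast_mul hB, ← sub_mul, abs_mul,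
    abs_of_pos (by positivity : (0 : ℝ) < (1 / 2) ^ n)]
  refine le_mul_of_one_le_left (by positivity) ?_
  have hz : ((∑ i ∈ A.image (n - 1 - ·), 2 ^ i : ℕ) : ℤ) - (∑ i ∈ B.image (n - 1 - ·), 2 ^ i : ℕ)
      ≠ 0 := by
    intro h0
    have h1 := Finset.geomSum_injective le_rfl (Nat.cast_injective (sub_eq_zero.1 h0))
    exact hne (Finset.Subset.antisymm (hinj hA hB h1) (hinj hB hA h1.symm))
  exact_mod_cast Int.one_le_abs hz

-- Near `x` the digits before `k` form one of three consecutive integers, the digits in `[k, m)`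
-- form a set of free positions, and the remaining tail is below `(1 / 2) ^ m`.
open Classical in
theorem exists_cover_digitSet (P : ℕ → Prop) (k m : ℕ) (x : ℝ) :
    ∃ T : Finset ℝ, T.card ≤ 3 * 2 ^ ((Finset.Ico k m).filter P).card ∧
      ∀ y ∈ digitSet P, |y - x| < (1 / 2) ^ k → ∃ t ∈ T, |y - t| < (1 / 2) ^ m := by
  refine ⟨(Finset.Icc (⌊x * 2 ^ k⌋ - 1) (⌊x * 2 ^ k⌋ + 1) ×ˢ
    ((Finset.Ico k m).filter P).powerset).image
      fun q => (q.1 : ℝ) * (1 / 2) ^ k + digitSum q.2, ?_, ?_⟩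
  · refine Finset.card_image_le.trans ?_
    rw [Finset.card_product, Finset.card_powerset, Int.card_Icc]
    gcongr
    omega
  · rintro y ⟨A, hA, rfl⟩ hy
    have hpk : (0 : ℝ) < 2 ^ k := by positivity
    have hhalf : (1 / 2 : ℝ) ^ k * 2 ^ k = 1 := by rw [← mul_pow]; norm_num
    obtain ⟨z, hz⟩ : ∃ z : ℤ, digitSum (A.filter (· < k)) = z * (1 / 2) ^ k :=
      ⟨_, (digitSum_eq_natCast_mul (A := A.filter (· < k)) (n := k) (by simp)).trans
        (by rw [← Int.cast_natCast])⟩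
    have hsplit := digitSum_filter_add A k
    have hsplit' := digitSum_filter_add (A.filter (k ≤ ·)) m
    have htail : digitSum (A.filter (k ≤ ·)) < (1 / 2) ^ k := digitSum_lt (by simp)
    have htail' : digitSum ((A.filter (k ≤ ·)).filter (m ≤ ·)) < (1 / 2) ^ m :=
      digitSum_lt (by simp)
    have h0 := digitSum_nonneg (A.filter (k ≤ ·))
    have h0' := digitSum_nonneg ((A.filter (k ≤ ·)).filter (m ≤ ·))
    have hfloor : ⌊digitSum A * 2 ^ k⌋ = z := by
      rw [Int.floor_eq_iff, ← hsplit, hz, add_mul, mul_assoc, hhalf, mul_one]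
      constructor
      · have := mul_nonneg h0 hpk.le
        linarith
      · have := mul_lt_mul_of_pos_right htail hpk
        rw [hhalf] at this
        linarith
    rw [abs_lt] at hy
    have hy1 : digitSum A * 2 ^ k < x * 2 ^ k + 1 := by
      have := mul_lt_mul_of_pos_right hy.2 hpk
      rw [hhalf] at this
      linarith
    have hy2 : x * 2 ^ k - 1 < digitSum A * 2 ^ k := by
      have := mul_lt_mul_of_pos_right hy.1 hpk
      rw [neg_mul, hhalf] at this
      linarith
    refine ⟨z * (1 / 2) ^ k + digitSum ((A.filter (k ≤ ·)).filter (· < m)),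
      Finset.mem_image.2 ⟨(z, (A.filter (k ≤ ·)).filter (· < m)), ?_, rfl⟩, ?_⟩
    · rw [Finset.mem_product, Finset.mem_Icc, Finset.mem_powerset]
      refine ⟨⟨?_, ?_⟩, ?_⟩
      · simp only
        rw [← hfloor, Int.le_floor]
        push_cast
        have := Int.floor_le (x * 2 ^ k)
        linarith
      · simp only
        rw [← hfloor, ← Int.lt_add_one_iff, Int.floor_lt]
        push_cast
        have := Int.lt_floor_add_one (x * 2 ^ k)
        linarith
      · intro j hj
        simp only [Finset.mem_filter, Finset.mem_Ico] at hj ⊢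
        exact ⟨⟨hj.1.2, hj.2⟩, hA j hj.1.1⟩
    · rw [abs_lt]
      constructor <;> linarith

/-! ### Comparison of the Euclidean distance with coordinates -/

/-- The crude `2 ^ d` replaces `√d` so that the loss is a shift by `d` binary digits. -/
theorem dist_lt_of_forall_abs_sub_lt {d : ℕ} {x y : EuclideanSpace ℝ (Fin d)} {s : ℝ} (hs : 0 < s)
    (h : ∀ i, |x i - y i| < s) : dist x y < 2 ^ d * s := by
  rw [EuclideanSpace.dist_eq, Real.sqrt_lt' (by positivity)]
  have h1 : ∑ i, dist (x i) (y i) ^ 2 ≤ ∑ _i : Fin d, s ^ 2 := by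
    refine Finset.sum_le_sum fun i _ => ?_
    rw [Real.dist_eq]
    exact pow_le_pow_left₀ (abs_nonneg _) (h i).le 2
  refine h1.trans_lt ?_
  rw [Finset.sum_const, Finset.card_univ, Fintype.card_fin, nsmul_eq_mul, mul_pow]
  have h2 : (d : ℝ) < 2 ^ d := by exact_mod_cast Nat.lt_two_pow_self
  have h3 : (1 : ℝ) ≤ 2 ^ d := one_le_pow₀ (by norm_num)
  have h4 : (2 : ℝ) ^ d ≤ (2 ^ d) ^ 2 := le_self_pow₀ h3 (by norm_num)
  have h5 : 0 < s ^ 2 := by positivity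
  exact mul_lt_mul_of_pos_right (h2.trans_le h4) h5

theorem abs_sub_le_dist {d : ℕ} (x y : EuclideanSpace ℝ (Fin d)) (i : Fin d) :
    |x i - y i| ≤ dist x y := by
  have := PiLp.norm_apply_le (x - y) i
  rw [dist_eq_norm]
  simpa using this

/-! ### Product sets -/

/-- The `d`-fold product of the translate of `digitSet P` by `a`. -/
def digitCube (d : ℕ) (P : ℕ → Prop) (a : ℝ) : Set (EuclideanSpace ℝ (Fin d)) :=
  {x | ∀ i, x i - a ∈ digitSet P}

open Classical in
theorem coverNum_digitCube_le {d : ℕ} (P : ℕ → Prop) (a : ℝ) (k m : ℕ) {δ r : ℝ}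
    (hδ : δ ≤ (1 / 2) ^ k) (hr : 2 ^ d * (1 / 2) ^ m ≤ r) (x : EuclideanSpace ℝ (Fin d)) :
    coverNum r (digitCube d P a ∩ Metric.ball x δ) ≤
      (3 * 2 ^ ((Finset.Ico k m).filter P).card) ^ d := by
  choose T hTcard hT using fun i => exists_cover_digitSet P k m (x i - a)
  refine (coverNum_le_card ((Fintype.piFinset T).image fun t => WithLp.toLp 2 fun i => a + t i)
    ?_).trans ?_
  · rintro y ⟨hy, hyx⟩
    have h1 : ∀ i, ∃ t ∈ T i, |y i - a - t| < (1 / 2) ^ m := by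
      intro i
      refine hT i _ (hy i) ?_
      have h2 := (abs_sub_le_dist y x i).trans_lt (Metric.mem_ball.1 hyx)
      rw [sub_sub_sub_cancel_right]
      exact h2.trans_le hδ
    choose t ht hty using h1
    simp only [mem_iUnion, Finset.mem_image, Fintype.mem_piFinset, exists_prop]
    refine ⟨_, ⟨t, ht, rfl⟩, ?_⟩
    rw [Metric.mem_ball]
    refine (dist_lt_of_forall_abs_sub_lt (by positivity) fun i => ?_).trans_le hr
    simpa [sub_sub] using hty i
  · refine Finset.card_image_le.trans ?_
    rw [Fintype.card_piFinset]
    refine (Finset.prod_le_prod' fun i _ => hTcard i).trans ?_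
    simp

open Classical in
theorem le_coverNum_digitCube {d : ℕ} (P : ℕ → Prop) (a : ℝ) {k n : ℕ} {δ r : ℝ}
    {F : Set (EuclideanSpace ℝ (Fin d))} (hF : digitCube d P a ⊆ F)
    (hδ : 2 ^ d * (1 / 2) ^ k ≤ δ) (hr : 0 < r) (hr2 : 2 * r ≤ (1 / 2) ^ n) :
    (2 ^ ((Finset.Ico k n).filter P).card) ^ d ≤
      coverNum r (F ∩ Metric.ball (WithLp.toLp 2 fun _ => a) δ) := by
  set U := ((Finset.Ico k n).filter P).powerset with hU
  have hcard : (Fintype.piFinset fun _ : Fin d => U).card =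
      (2 ^ ((Finset.Ico k n).filter P).card) ^ d := by
    simp [hU, Fintype.card_piFinset]
  rw [← hcard]
  have hUmem : ∀ A ∈ U, ∀ j ∈ A, k ≤ j ∧ j < n ∧ P j := by
    intro A hA j hj
    have := Finset.mem_powerset.1 hA hj
    simp only [Finset.mem_filter, Finset.mem_Ico] at this
    exact ⟨this.1.1, this.1.2, this.2⟩
  refine card_le_coverNum hr (Metric.isBounded_ball.subset inter_subset_right) _
    (fun A => WithLp.toLp 2 fun i => a + digitSum (A i)) ?_ ?_
  · intro A hA
    rw [Fintype.mem_piFinset] at hA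
    refine ⟨hF fun i => ⟨A i, fun j hj => (hUmem _ (hA i) j hj).2.2, by simp⟩, ?_⟩
    rw [Metric.mem_ball]
    refine (dist_lt_of_forall_abs_sub_lt (by positivity) fun i => ?_).trans_le hδ
    have h1 := digitSum_lt fun j hj => (hUmem _ (hA i) j hj).1
    simpa [abs_of_nonneg (digitSum_nonneg (A i))] using h1
  · intro A hA B hB hne
    rw [Fintype.mem_piFinset] at hA hB
    obtain ⟨i, hi⟩ := Function.ne_iff.1 hne
    refine hr2.trans ((le_abs_digitSum_sub (fun j hj => (hUmem _ (hA i) j hj).2.1)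
      (fun j hj => (hUmem _ (hB i) j hj).2.1) hi).trans ?_)
    simpa using abs_sub_le_dist (WithLp.toLp 2 fun i => a + digitSum (A i) :
      EuclideanSpace ℝ (Fin d)) (WithLp.toLp 2 fun i => a + digitSum (B i)) i

/-- Each product has coordinates in `[10 n, 10 n + 1)`, so a ball of radius at most `1` centred in
one product meets no other. -/
theorem mem_digitCube_of_dist_lt {d : ℕ} {P : ℕ → ℕ → Prop} {n n' : ℕ}
    {x y : EuclideanSpace ℝ (Fin d)} (hx : x ∈ digitCube d (P n) (10 * n))
    (hy : y ∈ digitCube d (P n') (10 * n')) (h : dist y x < 1) :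
    y ∈ digitCube d (P n) (10 * n) := by
  intro i
  obtain ⟨A, -, hA⟩ := hx i
  obtain ⟨B, hPB, hB⟩ := hy i
  have h1 := abs_lt.1 ((abs_sub_le_dist y x i).trans_lt h)
  have := digitSum_nonneg A
  have := digitSum_nonneg B
  have := digitSum_lt_one A
  have := digitSum_lt_one B
  have hlt : n' < n + 1 := by
    have : (n' : ℝ) < n + 1 := by linarith
    exact_mod_cast this
  have hlt' : n < n' + 1 := by
    have : (n : ℝ) < n' + 1 := by linarith
    exact_mod_cast this
  obtain rfl : n' = n := by omega
  exact ⟨B, hPB, hB⟩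

open Classical in
theorem card_filter_drop_add {P : ℕ → Prop} {c : ℕ → ℕ} (hP : ∀ j, P j ↔ c (j + 1) < c j)
    (hanti : Antitone c) (hstep : ∀ j, c j ≤ c (j + 1) + 1)
    {k m : ℕ} (h : k ≤ m) :
    ((Finset.Ico k m).filter P).card + c m = c k := by
  induction m, h using Nat.le_induction with
  | base => simp
  | succ m hm ih =>
    rw [← Finset.insert_Ico_right_eq_Ico_add_one hm, Finset.filter_insert]
    have h1 := hstep m
    have h2 := hanti (Nat.le_add_right m 1)
    split_ifs with h3
    · rw [hP] at h3
      rw [Finset.card_insert_of_notMem (by simp)]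
      omega
    · rw [hP] at h3
      omega

/-! ### Dimension profiles -/

/-- The rescaled function `t ↦ N g (t / N)` for `g t = (1 - t) ψ t`, continued by `0`
beyond `N`. -/
noncomputable def profile (ψ : ℝ → ℝ) (N t : ℝ) : ℝ := N * ((1 - min (t / N) 1) * ψ (min (t / N) 1))

/-- The conditions on a function on the closed unit interval under which it is, up to the
factor `d`, the Assouad spectrum of a subset of `ℝᵈ`. -/
structure IsProfile (ψ : ℝ → ℝ) : Prop where
  mem : ∀ t ∈ Icc (0 : ℝ) 1, ψ t ∈ Icc (0 : ℝ) 1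
  mono : MonotoneOn ψ (Icc 0 1)
  anti : AntitoneOn (fun t => (1 - t) * ψ t) (Icc 0 1)

theorem min_div_mem_Icc {N t : ℝ} (hN : 0 < N) (ht : 0 ≤ t) : min (t / N) 1 ∈ Icc (0 : ℝ) 1 :=
  ⟨le_min (by positivity) zero_le_one, min_le_right _ _⟩

namespace IsProfile

variable {ψ : ℝ → ℝ}

theorem profile_nonneg (hψ : IsProfile ψ) {N t : ℝ} (hN : 0 < N) (ht : 0 ≤ t) :
    0 ≤ profile ψ N t := by
  have h1 := min_div_mem_Icc hN ht
  exact mul_nonneg hN.le (mul_nonneg (by linarith [h1.2]) (hψ.mem _ h1).1)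

theorem profile_anti (hψ : IsProfile ψ) {N s t : ℝ} (hN : 0 < N) (hs : 0 ≤ s) (hst : s ≤ t) :
    profile ψ N t ≤ profile ψ N s := by
  refine mul_le_mul_of_nonneg_left ?_ hN.le
  exact hψ.anti (min_div_mem_Icc hN hs) (min_div_mem_Icc hN (hs.trans hst))
    (min_le_min_right _ (by gcongr))

/-- For `u ≤ v`, monotonicity of `ψ` bounds the fall of `(1 - t) ψ t` by `(v - u) ψ u ≤ v - u`.
Hence one digit per position suffices. -/
theorem profile_le_add (hψ : IsProfile ψ) {N s t : ℝ} (hN : 0 < N) (hs : 0 ≤ s) (hst : s ≤ t) :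
    profile ψ N s ≤ profile ψ N t + (t - s) := by
  have hu := min_div_mem_Icc hN hs
  have hv := min_div_mem_Icc hN (hs.trans hst)
  have huv : min (s / N) 1 ≤ min (t / N) 1 := min_le_min_right _ (by gcongr)
  have hdiff : N * (min (t / N) 1 - min (s / N) 1) ≤ t - s := by
    have h1 : min (t / N) 1 - min (s / N) 1 ≤ t / N - s / N := by
      have : s / N ≤ t / N := by gcongr
      rcases le_total (s / N) 1 with h | h
      · rw [min_eq_left h]
        linarith [min_le_left (t / N) 1]
      · rw [min_eq_right h, min_eq_right (h.trans this)]
        linarith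
    calc _ ≤ N * (t / N - s / N) := by gcongr
      _ = t - s := by field_simp
  unfold profile
  set u := min (s / N) 1
  set v := min (t / N) 1
  have hm := hψ.mono hu hv huv
  have h1 : (1 - u) * ψ u ≤ (1 - v) * ψ v + (v - u) := by
    nlinarith [(hψ.mem u hu).2, hu.2, hv.2, (hψ.mem u hu).1]
  nlinarith

/-- With `u = L / (θ N)`: if `u ≤ 1`, then `ψ (u θ)` is at most both `ψ u` and `ψ θ`; if `u ≥ 1`,
the second term vanishes and `(1 - t) ψ t` at `min (u θ) 1` is at most its value at `θ`. -/
theorem profile_sub_le (hψ : IsProfile ψ) {N θ L : ℝ} (hN : 0 < N) (hθ : θ ∈ Ioo (0 : ℝ) 1)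
    (hL : 0 ≤ L) : profile ψ N L - profile ψ N (L / θ) ≤ (L / θ - L) * ψ θ := by
  have hθ' : θ ∈ Icc (0 : ℝ) 1 := ⟨hθ.1.le, hθ.2.le⟩
  have hL' : 0 ≤ L / θ := div_nonneg hL hθ.1.le
  have hψθ := (hψ.mem θ hθ').1
  obtain ⟨u, hu⟩ : ∃ u, u = L / θ / N := ⟨_, rfl⟩
  have hu0 : 0 ≤ u := hu ▸ by positivity
  have hLu : L / N = u * θ := by
    have := hθ.1
    rw [hu]
    field_simp
  have hLθ : L / θ = N * u := by rw [hu]; field_simp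
  have hL2 : L = N * (u * θ) := by rw [← hLu]; field_simp
  rw [hLθ]
  unfold profile
  rw [hLu, mul_div_cancel_left₀ _ hN.ne']
  conv_rhs => rw [hL2]
  rw [← mul_sub, ← mul_sub, mul_assoc]
  refine mul_le_mul_of_nonneg_left ?_ hN.le
  rcases le_total u 1 with h | h
  · have huθ : u * θ ≤ u := mul_le_of_le_one_right hu0 hθ.2.le
    have huθ' : u * θ ≤ θ := mul_le_of_le_one_left hθ.1.le h
    have hmem : u * θ ∈ Icc (0 : ℝ) 1 := ⟨mul_nonneg hu0 hθ.1.le, huθ.trans h⟩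
    rw [min_eq_left h, min_eq_left hmem.2]
    have h1 := hψ.mono hmem ⟨hu0, h⟩ huθ
    have h2 := hψ.mono hmem hθ' huθ'
    nlinarith [mul_le_mul_of_nonneg_left h1 (sub_nonneg.2 h),
      mul_le_mul_of_nonneg_left h2 (sub_nonneg.2 huθ)]
  · have huθ' : θ ≤ u * θ := le_mul_of_one_le_left hθ.1.le h
    have hmem : min (u * θ) 1 ∈ Icc (0 : ℝ) 1 :=
      ⟨le_min (mul_nonneg hu0 hθ.1.le) zero_le_one, min_le_right _ _⟩
    rw [min_eq_right h]
    have h1 := hψ.anti hθ' hmem (le_min huθ' hθ.2.le)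
    simp only at h1
    have h2 : 0 ≤ (1 - θ) * ψ θ := mul_nonneg (by linarith [hθ.2]) hψθ
    nlinarith

end IsProfile

/-- The number of free digits from position `j` on in the expansions of length `n + 1`. -/
noncomputable def freeDigits (ψ : ℝ → ℝ) (n j : ℕ) : ℕ := ⌊profile ψ (n + 1) j⌋₊

/-- The positions at which the digit may be chosen freely. -/
def IsFree (ψ : ℝ → ℝ) (n j : ℕ) : Prop := freeDigits ψ n (j + 1) < freeDigits ψ n j

/-- The union of far apart finite product sets, one for each length of the expansions. -/
def spectrumSet (d : ℕ) (ψ : ℝ → ℝ) : Set (EuclideanSpace ℝ (Fin d)) :=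
  ⋃ n : ℕ, digitCube d (IsFree ψ n) (10 * n)

/-! ### The Assouad spectrum of the digit sets -/

namespace IsProfile

variable {ψ : ℝ → ℝ}

open Classical in
theorem card_filter_freeDigits_add (hψ : IsProfile ψ) (n : ℕ) {k m : ℕ} (h : k ≤ m) :
    ((Finset.Ico k m).filter (IsFree ψ n)).card +
      freeDigits ψ n m = freeDigits ψ n k := by
  have hN : (0 : ℝ) < n + 1 := by positivity
  refine card_filter_drop_add (fun _ => Iff.rfl) ?_ ?_ h
  · intro i j hij
    exact Nat.floor_le_floor (hψ.profile_anti hN (Nat.cast_nonneg i) (Nat.cast_le.2 hij))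
  · intro j
    have h0 := hψ.profile_nonneg hN (Nat.cast_nonneg (j + 1))
    unfold freeDigits
    rw [← Nat.floor_add_one h0]
    refine Nat.floor_le_floor ?_
    have := hψ.profile_le_add hN (Nat.cast_nonneg j) (Nat.cast_le.2 (Nat.le_add_right j 1))
    push_cast at this ⊢
    linarith

theorem freeDigits_le (hψ : IsProfile ψ) (n j : ℕ) : (freeDigits ψ n j : ℝ) ≤ profile ψ (n + 1) j :=
  Nat.floor_le (hψ.profile_nonneg (by positivity) (Nat.cast_nonneg j))

theorem lt_freeDigits_add_one (n j : ℕ) : profile ψ (n + 1) j < freeDigits ψ n j + 1 :=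
  Nat.lt_floor_add_one _

theorem mem_admissibleExponents_spectrumSet (hψ : IsProfile ψ) (d : ℕ) {θ : ℝ}
    (hθ : θ ∈ Ioo (0 : ℝ) 1) : d * ψ θ ∈ admissibleExponents θ (spectrumSet d ψ) := by
  classical
  -- Per coordinate: `3` counts the initial blocks, and `d + 3` is the `d` extra digits in `m` plus
  -- one each for rounding `k`, `m` and the floors.
  refine ⟨3 ^ d * 2 ^ ((d + 3) * d), by positivity, fun δ hδ hδ1 x hx => ?_⟩
  obtain ⟨n, hn⟩ := mem_iUnion.1 hx
  have hN : (0 : ℝ) < n + 1 := by positivity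
  obtain ⟨L, hL0, rfl⟩ : ∃ L : ℝ, 0 ≤ L ∧ δ = 2 ^ (-L) := by
    refine ⟨-Real.logb 2 δ, ?_, ?_⟩
    · have := Real.logb_nonpos (b := 2) (by norm_num) hδ.le hδ1
      linarith
    · rw [neg_neg, Real.rpow_logb (by norm_num) (by norm_num) hδ]
  have hLθ : L ≤ L / θ := by
    rw [le_div_iff₀ hθ.1]
    exact mul_le_of_le_one_right hL0 hθ.2.le
  have hLθ0 : 0 ≤ L / θ := hL0.trans hLθ
  set k := ⌊L⌋₊ with hk
  set m := ⌈L / θ⌉₊ + d with hm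
  have hkL : (k : ℝ) ≤ L := Nat.floor_le hL0
  have hkL' : L < k + 1 := Nat.lt_floor_add_one L
  have hmL : L / θ + d ≤ (m : ℝ) := by
    rw [hm]; push_cast
    linarith [Nat.le_ceil (L / θ)]
  have hmL' : (m : ℝ) < L / θ + 1 + d := by
    rw [hm]; push_cast
    linarith [Nat.ceil_lt_add_one hLθ0]
  have hkm : k ≤ m := by
    have : (k : ℝ) ≤ m := by
      have : (0 : ℝ) ≤ d := Nat.cast_nonneg d
      linarith
    exact_mod_cast this
  have hhalf : ∀ j : ℕ, (1 / 2 : ℝ) ^ j = 2 ^ (-(j : ℝ)) := by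
    intro j
    rw [Real.rpow_neg (by norm_num), Real.rpow_natCast, one_div, inv_pow]
  have hR : ((2 : ℝ) ^ (-L)) ^ (1 / θ) = 2 ^ (-(L / θ)) := by
    rw [← Real.rpow_mul (by norm_num)]
    congr 1
    ring
  rw [hR]
  have hsub : spectrumSet d ψ ∩ Metric.ball x (2 ^ (-L)) ⊆
      digitCube d (IsFree ψ n) (10 * n) ∩ Metric.ball x (2 ^ (-L)) := by
    rintro y ⟨hy, hyx⟩
    obtain ⟨n', hn'⟩ := mem_iUnion.1 hy
    exact ⟨mem_digitCube_of_dist_lt (P := IsFree ψ) hn hn' ((Metric.mem_ball.1 hyx).trans_le hδ1), hyx⟩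
  have hcov := (coverNum_mono (Real.rpow_pos_of_pos two_pos (-(L / θ)))
    (Metric.isBounded_ball.subset inter_subset_right) hsub).trans
    (coverNum_digitCube_le (IsFree ψ n) (10 * n) k m (r := 2 ^ (-(L / θ))) (δ := 2 ^ (-L))
      (by
        rw [hhalf]
        exact Real.rpow_le_rpow_of_exponent_le (by norm_num) (by linarith))
      (by
        rw [hhalf, ← Real.rpow_natCast, ← Real.rpow_add (by norm_num)]
        exact Real.rpow_le_rpow_of_exponent_le (by norm_num) (by linarith)) x)
  have hcount := hψ.card_filter_freeDigits_add n hkm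
  set K := ((Finset.Ico k m).filter (IsFree ψ n)).card with hK
  have hKle : (K : ℝ) ≤ (L / θ - L) * ψ θ + (d + 3) := by
    have h1 : (K : ℝ) + freeDigits ψ n m = freeDigits ψ n k := by exact_mod_cast hcount
    have h2 := hψ.freeDigits_le n k
    have h3 := lt_freeDigits_add_one (ψ := ψ) n m
    have h4 := hψ.profile_le_add hN (Nat.cast_nonneg k) hkL
    have h5 := hψ.profile_le_add hN hLθ0
      (show L / θ ≤ (m : ℝ) by linarith [(Nat.cast_nonneg d : (0 : ℝ) ≤ d)])
    have h6 := hψ.profile_sub_le hN hθ hL0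
    linarith
  calc (coverNum (2 ^ (-(L / θ))) (spectrumSet d ψ ∩ Metric.ball x (2 ^ (-L))) : ℝ)
      ≤ (3 * 2 ^ K) ^ d := by exact_mod_cast hcov
    _ = 3 ^ d * (2 : ℝ) ^ ((K : ℝ) * d) := by
        rw [mul_pow, ← pow_mul, ← Nat.cast_mul, Real.rpow_natCast]
    _ ≤ 3 ^ d * (2 : ℝ) ^ (((L / θ - L) * ψ θ + (d + 3)) * d) := by
        gcongr
        norm_num
    _ = 3 ^ d * 2 ^ ((d + 3) * d) * (2 ^ (-L) / 2 ^ (-(L / θ))) ^ (d * ψ θ) := by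
        rw [← Real.rpow_sub (by norm_num), ← Real.rpow_mul (by norm_num), mul_assoc,
          ← Real.rpow_natCast 2 ((d + 3) * d), ← Real.rpow_add (by norm_num)]
        congr 2
        push_cast
        ring

theorem le_of_mem_admissibleExponents_spectrumSet (hψ : IsProfile ψ) (d : ℕ) {θ α : ℝ}
    (hθ : θ ∈ Ioo (0 : ℝ) 1) (hα : α ∈ admissibleExponents θ (spectrumSet d ψ)) :
    d * ψ θ ≤ α := by
  classical
  obtain ⟨C, hC, H⟩ := hα
  have hθ1 : 0 < 1 - θ := by linarith [hθ.2]
  -- Tested at the corner of the `n`-th product with `δ ^ (1 / θ) = 2 ^ (-(n + 2))`, half the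
  -- separation `2 ^ (-(n + 1))` of its points; `d + 4` absorbs the rounding.
  have key : ∀ n : ℕ, ((n + 1) * ((1 - θ) * ψ θ) - (d + 4)) * d ≤
      Real.logb 2 C + (n + 2) * (1 - θ) * α := by
    intro n
    have hN : (0 : ℝ) < n + 1 := by positivity
    have hhalf : ∀ j : ℕ, (1 / 2 : ℝ) ^ j = 2 ^ (-(j : ℝ)) := by
      intro j
      rw [Real.rpow_neg (by norm_num), Real.rpow_natCast, one_div, inv_pow]
    have hnθ : 0 ≤ (n + 2) * θ := mul_nonneg (by positivity) hθ.1.le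
    set k := ⌈(n + 2) * θ⌉₊ + d with hk
    have hkL : (n + 2) * θ + d ≤ (k : ℝ) := by
      rw [hk]; push_cast
      linarith [Nat.le_ceil ((n + 2) * θ)]
    have hkL' : (k : ℝ) < (n + 2) * θ + 1 + d := by
      rw [hk]; push_cast
      linarith [Nat.ceil_lt_add_one hnθ]
    have hR : ((2 : ℝ) ^ (-((n + 2) * θ))) ^ (1 / θ) = 2 ^ (-((n : ℝ) + 2)) := by
      rw [← Real.rpow_mul (by norm_num)]
      congr 1
      have := hθ.1.ne'
      field_simp
    have hlow := le_coverNum_digitCube (d := d) (IsFree ψ n) (10 * n) (k := k) (n := n + 1)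
      (δ := 2 ^ (-((n + 2) * θ))) (r := 2 ^ (-((n : ℝ) + 2)))
      (subset_iUnion (fun n : ℕ => digitCube d (IsFree ψ n) (10 * n)) n)
      (by
        rw [hhalf, ← Real.rpow_natCast, ← Real.rpow_add (by norm_num)]
        exact Real.rpow_le_rpow_of_exponent_le (by norm_num) (by linarith))
      (by positivity)
      (by
        rw [hhalf]
        conv_lhs => rw [← Real.rpow_one 2]
        rw [← Real.rpow_mul (by norm_num), ← Real.rpow_add (by norm_num)]
        exact Real.rpow_le_rpow_of_exponent_le (by norm_num) (by push_cast; linarith))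
    have hmem : (WithLp.toLp 2 fun _ => 10 * (n : ℝ) : EuclideanSpace ℝ (Fin d)) ∈
        spectrumSet d ψ :=
      mem_iUnion.2 ⟨n, fun i => ⟨∅, by simp, by simp [digitSum]⟩⟩
    have hup := H (2 ^ (-((n + 2) * θ))) (by positivity)
      (Real.rpow_le_one_of_one_le_of_nonpos (by norm_num) (by linarith)) _ hmem
    rw [hR] at hup
    set K := ((Finset.Ico k (n + 1)).filter (IsFree ψ n)).card with hK
    have hKge : (n + 1) * ((1 - θ) * ψ θ) - (d + 4) ≤ (K : ℝ) := by
      have hprof : profile ψ (n + 1) ((n + 1) * θ) = (n + 1) * ((1 - θ) * ψ θ) := by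
        rw [profile, mul_div_cancel_left₀ _ hN.ne', min_eq_left hθ.2.le]
      have h4 := hψ.profile_le_add hN (s := (n + 1) * θ) (t := k) (mul_nonneg hN.le hθ.1.le)
        (by nlinarith [hθ.1, (Nat.cast_nonneg d : (0 : ℝ) ≤ d)])
      have h5 := lt_freeDigits_add_one (ψ := ψ) n k
      have h6 : (freeDigits ψ n k : ℝ) ≤ K := by
        rcases le_total k (n + 1) with h | h
        · have h7 := hψ.card_filter_freeDigits_add n h
          have h8 : freeDigits ψ n (n + 1) = 0 := by
            simp [freeDigits, profile, div_self hN.ne']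
          rw [h8, add_zero] at h7
          exact_mod_cast h7.symm.le
        · have h9 : (n : ℝ) + 1 ≤ k := by exact_mod_cast h
          have h8 : freeDigits ψ n k = 0 := by
            simp [freeDigits, profile, min_eq_right ((one_le_div hN).2 h9)]
          rw [h8]
          simp
      nlinarith [hθ.2]
    have hfin : (2 : ℝ) ^ ((K : ℝ) * d) ≤ C * 2 ^ ((n + 2) * (1 - θ) * α) := by
      have h1 : (2 : ℝ) ^ ((K : ℝ) * d) = (((2 ^ K) ^ d : ℕ) : ℝ) := by
        push_cast
        rw [← pow_mul, ← Nat.cast_mul, Real.rpow_natCast]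
      rw [h1]
      refine ((Nat.cast_le.2 hlow).trans hup).trans_eq ?_
      rw [← Real.rpow_sub (by norm_num), ← Real.rpow_mul (by norm_num)]
      congr 2
      ring
    have hlog := Real.logb_le_logb_of_le (b := 2) (by norm_num) (by positivity) hfin
    rw [Real.logb_mul hC.ne' (by positivity), Real.logb_rpow (by norm_num) (by norm_num),
      Real.logb_rpow (by norm_num) (by norm_num)] at hlog
    have := mul_le_mul_of_nonneg_right hKge (Nat.cast_nonneg d : (0 : ℝ) ≤ d)
    linarith
  -- Both sides of `key` are affine in `n`, so large `n` compares the slopes.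
  by_contra hlt
  push Not at hlt
  have hpos : 0 < (1 - θ) * (d * ψ θ - α) := mul_pos hθ1 (by linarith)
  obtain ⟨n, hn⟩ := exists_nat_gt
    ((Real.logb 2 C + (1 - θ) * α + (d + 4) * d) / ((1 - θ) * (d * ψ θ - α)))
  rw [div_lt_iff₀ hpos] at hn
  have := key n
  nlinarith

theorem assouadSpectrum_spectrumSet (hψ : IsProfile ψ) (d : ℕ) {θ : ℝ} (hθ : θ ∈ Ioo (0 : ℝ) 1) :
    assouadSpectrum θ (spectrumSet d ψ) = ((d * ψ θ : ℝ) : EReal) := by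
  refine le_antisymm (sInf_le ⟨_, hψ.mem_admissibleExponents_spectrumSet d hθ, rfl⟩)
    (le_sInf ?_)
  rintro _ ⟨α, hα, rfl⟩
  exact EReal.coe_le_coe_iff.2 (hψ.le_of_mem_admissibleExponents_spectrumSet d hθ hα)

end IsProfile

/-- A suitable function on the open unit interval extends to the closed one. -/
theorem exists_isProfile_eqOn {ψ : ℝ → ℝ} (hmem : ∀ θ ∈ Ioo (0 : ℝ) 1, ψ θ ∈ Icc (0 : ℝ) 1)
    (hmono : MonotoneOn ψ (Ioo (0 : ℝ) 1))
    (hanti : AntitoneOn (fun θ : ℝ => (1 - θ) * ψ θ) (Ioo (0 : ℝ) 1)) :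
    ∃ ψ' : ℝ → ℝ, IsProfile ψ' ∧ EqOn ψ' ψ (Ioo 0 1) := by
  set I := sInf (ψ '' Ioo 0 1) with hI
  have hne : (ψ '' Ioo (0 : ℝ) 1).Nonempty := (nonempty_Ioo.2 zero_lt_one).image ψ
  have hbdd : BddBelow (ψ '' Ioo (0 : ℝ) 1) :=
    ⟨0, by rintro _ ⟨θ, hθ, rfl⟩; exact (hmem θ hθ).1⟩
  have hI0 : 0 ≤ I := le_csInf hne (by rintro _ ⟨θ, hθ, rfl⟩; exact (hmem θ hθ).1)
  have hIle : ∀ θ ∈ Ioo (0 : ℝ) 1, I ≤ ψ θ := fun θ hθ => csInf_le hbdd ⟨θ, hθ, rfl⟩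
  have hIge : ∀ θ ∈ Ioo (0 : ℝ) 1, (1 - θ) * ψ θ ≤ I := by
    intro θ hθ
    refine le_csInf hne ?_
    rintro _ ⟨s, hs, rfl⟩
    rcases le_total s θ with h | h
    · have h1 := hanti hs hθ h
      simp only at h1
      nlinarith [(hmem s hs).1, hs.1]
    · have h1 := hmono hθ hs h
      nlinarith [(hmem θ hθ).1, hθ.1]
  have hI1 : I ≤ 1 := (hIle (1 / 2) (by norm_num)).trans (hmem (1 / 2) (by norm_num)).2
  -- The infimum at `0` keeps both monotonicities; at `1` the factor `1 - t` vanishes, so the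
  -- largest value `1` is harmless.
  set ψ' : ℝ → ℝ := fun t => if t ≤ 0 then I else if t < 1 then ψ t else 1 with hψ'
  have e0 : ∀ t ≤ 0, ψ' t = I := fun t ht => by simp [hψ', ht]
  have em : ∀ t ∈ Ioo (0 : ℝ) 1, ψ' t = ψ t := fun t ht => by
    simp [hψ', not_le.2 ht.1, ht.2]
  have e1 : ∀ t, 1 ≤ t → ψ' t = 1 := fun t ht => by
    simp [hψ', not_le.2 (zero_lt_one.trans_le ht), not_lt.2 ht]
  have hcases : ∀ t ∈ Icc (0 : ℝ) 1, t = 0 ∨ t ∈ Ioo (0 : ℝ) 1 ∨ t = 1 := by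
    intro t ht
    rcases ht.1.eq_or_lt with h | h
    · exact Or.inl h.symm
    · rcases ht.2.eq_or_lt with h' | h'
      · exact Or.inr (Or.inr h')
      · exact Or.inr (Or.inl ⟨h, h'⟩)
  refine ⟨ψ', ⟨?_, ?_, ?_⟩, em⟩
  · intro t ht
    rcases hcases t ht with rfl | h | rfl
    · rw [e0 0 le_rfl]
      exact ⟨hI0, hI1⟩
    · rw [em t h]
      exact hmem t h
    · rw [e1 1 le_rfl]
      exact ⟨zero_le_one, le_rfl⟩
  · intro s hs t ht hst
    rcases hcases s hs with rfl | h | rfl <;> rcases hcases t ht with rfl | h' | rfl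
    · exact le_rfl
    · rw [e0 0 le_rfl, em t h']
      exact hIle t h'
    · rw [e0 0 le_rfl, e1 1 le_rfl]
      exact hI1
    · exact absurd hst (not_le.2 h.1)
    · rw [em s h, em t h']
      exact hmono h h' hst
    · rw [em s h, e1 1 le_rfl]
      exact (hmem s h).2
    · norm_num at hst
    · exact absurd hst (not_le.2 h'.2)
    · exact le_rfl
  · intro s hs t ht hst
    simp only
    rcases hcases t ht with rfl | h' | rfl
    · obtain rfl : s = 0 := le_antisymm hst hs.1
      exact le_rfl
    · rcases hcases s hs with rfl | h | rfl
      · rw [e0 0 le_rfl, em t h']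
        simpa using hIge t h'
      · rw [em s h, em t h']
        exact hanti h h' hst
      · exact absurd hst (not_le.2 h'.2)
    · rcases hcases s hs with rfl | h | rfl
      · rw [e0 0 le_rfl]
        simpa using hI0
      · rw [em s h, sub_self, zero_mul]
        exact mul_nonneg (by linarith [h.2]) (hmem s h).1
      · exact le_rfl

end AssouadForms

theorem mainTheorem6 (d : ℕ) (φ : ℝ → ℝ)
    (hφ : ∀ θ ∈ Set.Ioo (0 : ℝ) 1, φ θ ∈ Set.Icc (0 : ℝ) (d : ℝ))
    (hmono : MonotoneOn φ (Set.Ioo (0 : ℝ) 1)) :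
    (∃ F : Set (EuclideanSpace ℝ (Fin d)),
        ∀ θ ∈ Set.Ioo (0 : ℝ) 1, AssouadForms.assouadSpectrum θ F = (φ θ : EReal)) ↔
      AntitoneOn (fun θ : ℝ => (1 - θ) * φ θ) (Set.Ioo (0 : ℝ) 1) := by
  refine ⟨fun ⟨F, hF⟩ => AssouadForms.antitoneOn_of_assouadSpectrum_eq hF, fun hanti => ?_⟩
  have hd : (0 : ℝ) ≤ d := Nat.cast_nonneg d
  obtain ⟨ψ, hψ, heq⟩ := AssouadForms.exists_isProfile_eqOn (ψ := fun θ => φ θ / d)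
    (fun θ hθ => ⟨div_nonneg (hφ θ hθ).1 hd, div_le_one_of_le₀ (hφ θ hθ).2 hd⟩)
    (fun s hs t ht hst => div_le_div_of_nonneg_right (hmono hs ht hst) hd)
    (fun s hs t ht hst => by
      simp only [← mul_div_assoc]
      exact div_le_div_of_nonneg_right (hanti hs ht hst) hd)
  refine ⟨AssouadForms.spectrumSet d ψ, fun θ hθ => ?_⟩
  rw [hψ.assouadSpectrum_spectrumSet d hθ, heq hθ]
  congr 1
  -- For `d = 0` the quotient is the default `0`, and the bounds force `φ θ = 0`.
  refine mul_div_cancel_of_imp' fun h0 => ?_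
  have := hφ θ hθ
  rw [h0] at this
  exact le_antisymm this.2 this.1
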